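/- Let $M$ be a finite (von Neumann) regular monoid, i.e. a finite monoid such that for every $s\in M$ there is $t\in M$ with $sts=s$. For $n\ge 0$ let $H_n(M,\mathbb Z)=\operatorname{Tor}_n^{\mathbb ZM}(\mathbb Z,\mathbb Z)$ be the $n$-th homology group of $M$, where $\mathbb ZM$ is the monoid ring and each copy of $\mathbb Z$ is the trivial (right, respectively left) $\mathbb ZM$-module, on which every element of $M$ acts as the identity. Then $H_n(M,\mathbb Z)$ is finite for all sufficiently large $n$; that is, there is $N\in\mathbb N$ (depending on $M$) such that $H_n(M,\mathbb Z)$ is a finite group for every $n\ge N$. -/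

import Mathlib

universe u v w

open CategoryTheory
open scoped TensorProduct

noncomputable section

namespace MonoidHomology

/-- A (von Neumann) regular semigroup: for every `s` there is `t` with `s * t * s = s`. -/
def IsRegularSemigroup (S : Type*) [Semigroup S] : Prop :=
  ∀ s : S, ∃ t : S, s * t * s = s

section Tensor

/-! ### The tensor product `B ⊗_R A` over a possibly noncommutative ring

A right `R`-module is a left module over the opposite ring `Rᵐᵒᵖ`. -/

variable (R : Type u) [Ring R] (B : Type w) [AddCommGroup B] [Module Rᵐᵒᵖ B]

/-- The subgroup of `B ⊗[ℤ] A` generated by the elements `b r ⊗ a - b ⊗ r a`. -/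
def balancedRel (A : Type v) [AddCommGroup A] [Module R A] : AddSubgroup (B ⊗[ℤ] A) :=
  AddSubgroup.closure
    {x | ∃ (b : B) (r : R) (a : A),
      x = (MulOpposite.op r • b) ⊗ₜ[ℤ] a - b ⊗ₜ[ℤ] (r • a)}

/-- The abelian group `B ⊗_R A`, for a right `R`-module `B` and a left `R`-module `A`. -/
abbrev BalancedTensor (A : Type v) [AddCommGroup A] [Module R A] : Type (max w v) :=
  (B ⊗[ℤ] A) ⧸ balancedRel R B A

variable {B} in
/-- The element `b ⊗ a` of `B ⊗_R A`. -/
def btmul {A : Type v} [AddCommGroup A] [Module R A] (b : B) (a : A) : BalancedTensor R B A :=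
  QuotientAddGroup.mk' (balancedRel R B A) (b ⊗ₜ[ℤ] a)

variable {R B} in
/-- Two additive maps out of `B ⊗_R A` are equal if they agree on all `b ⊗ a`. -/
theorem balanced_hom_ext {A : Type v} [AddCommGroup A] [Module R A]
    {C : Type*} [AddCommGroup C] {f g : BalancedTensor R B A →+ C}
    (h : ∀ (b : B) (a : A), f (btmul R b a) = g (btmul R b a)) : f = g :=
  QuotientAddGroup.addMonoidHom_ext _ (AddMonoidHom.ext fun x =>
    TensorProduct.induction_on x ((map_zero _).trans (map_zero _).symm) h fun x y hx hy =>
      (map_add _ x y).trans ((congrArg₂ (· + ·) hx hy).trans (map_add _ x y).symm))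

/-- The map `id ⊗ f : B ⊗_R A → B ⊗_R A'` induced by an `R`-linear map `f : A → A'`. -/
def balancedMap {A : Type v} {A' : Type v} [AddCommGroup A] [Module R A]
    [AddCommGroup A'] [Module R A'] (f : A →ₗ[R] A') :
    BalancedTensor R B A →+ BalancedTensor R B A' :=
  QuotientAddGroup.map _ _
    (TensorProduct.map LinearMap.id f.toAddMonoidHom.toIntLinearMap).toAddMonoidHom (by
      rw [balancedRel, AddSubgroup.closure_le]
      rintro _ ⟨b, r, a, rfl⟩
      refine AddSubgroup.subset_closure ⟨b, r, f a, ?_⟩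
      simp)

/-- The functor `B ⊗_R -` from left `R`-modules to abelian groups. -/
def tensorFunctor : ModuleCat.{v} R ⥤ AddCommGrpCat.{max w v} where
  obj A := AddCommGrpCat.of (BalancedTensor R B A)
  map f := AddCommGrpCat.ofHom (balancedMap R B f.hom)
  map_id _ := AddCommGrpCat.hom_ext (balanced_hom_ext fun _ _ => rfl)
  map_comp _ _ := AddCommGrpCat.hom_ext (balanced_hom_ext fun _ _ => rfl)

instance tensorFunctor_additive : (tensorFunctor.{u, v, w} R B).Additive where
  map_add {_ A'} f g := AddCommGrpCat.hom_ext (balanced_hom_ext fun b a =>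
    (congrArg (QuotientAddGroup.mk' (balancedRel R B A'))
      (TensorProduct.tmul_add b (f.hom a) (g.hom a))).trans (map_add _ _ _))

/-- `Tor_n^R(B, A)`, for a right `R`-module `B` and a left `R`-module `A`: the value at `A` of
the `n`-th left derived functor of `B ⊗_R -`. -/
def TorGroup [Small.{v} R] (A : ModuleCat.{v} R) (n : ℕ) : AddCommGrpCat.{max w v} :=
  ((tensorFunctor.{u, v, w} R B).leftDerived n).obj A

end Tensor

section Homology

/-- The underlying abelian group `ℤ` (in the universe of `M`) of the trivial `ℤM`-module. -/
def TrivialModule (_M : Type u) : Type u := ULift.{u} ℤ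

variable (M : Type u)

instance : AddCommGroup (TrivialModule M) := inferInstanceAs (AddCommGroup (ULift.{u} ℤ))

variable [Monoid M]

/-- The augmentation `ℤM → ℤ`, sending every element of `M` to `1`. -/
def augmentation : MonoidAlgebra ℤ M →+* ℤ :=
  (MonoidAlgebra.lift ℤ ℤ M (1 : M →* ℤ)).toRingHom

/-- The trivial left `ℤM`-module: every element of `M` acts as the identity on `ℤ`. -/
instance : Module (MonoidAlgebra ℤ M) (TrivialModule M) :=
  Module.compHom (TrivialModule M) (augmentation M)

/-- The trivial right `ℤM`-module: every element of `M` acts as the identity on `ℤ`. -/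
instance : Module (MonoidAlgebra ℤ M)ᵐᵒᵖ (TrivialModule M) :=
  Module.compHom (TrivialModule M)
    ((augmentation M).fromOpposite fun _ _ => Commute.all _ _)

/-- `H_n(M, A) = Tor_n^{ℤM}(ℤ, A)`, the `n`-th homology group of the monoid `M` with coefficients
in the left `ℤM`-module `A`, where `ℤ` is the trivial right `ℤM`-module. -/
def homology (A : ModuleCat.{u} (MonoidAlgebra ℤ M)) (n : ℕ) : AddCommGrpCat.{u} :=
  TorGroup.{u, u, u} (MonoidAlgebra ℤ M) (TrivialModule M) A n

/-- `H_n(M, ℤ)`, the `n`-th homology group of `M` with trivial coefficients `ℤ`. -/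
def integralHomology (n : ℕ) : AddCommGrpCat.{u} :=
  homology M (ModuleCat.of (MonoidAlgebra ℤ M) (TrivialModule M)) n

end Homology

end MonoidHomology

end

/-! Call a module V good if one positive integer kills Ext^n(V, -) for all large n. For V finitely
generated over ℤM this forces finiteness of Tor: some multiple m of the identity of a resolution of
V by finitely generated projectives is null-homotopic in high degrees, tensoring keeps the homotopy,
and a finitely generated abelian group killed by m is finite. Good modules are closed under
extensions, cokernels of injections, and retracts up to a positive multiple.

Every ℤM-module V finitely generated over ℤ is good (`eventuallyTorsionExt_of_ideal`). Let I be an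
ideal killing V, e an idempotent J-minimal outside I (regularity supplies it), G the unit group of
eMe and L the L-class of e. The action map ℤL ⊗_{ℤG} eV → V has kernel and cokernel killed by the
larger ideal I ∪ MeM, so induction handles both. Averaging over G makes the induced module a
retract, up to |G|, of ℤL ⊗_ℤ eV (`eventuallyTorsionExt_induced`), itself a retract up to a multiple
of a power of ℤL. Finally ℤL is the quotient of the projective module ℤ[Me] by the span of the
elements of Me strictly J-below e, and that span is good by induction along the J-order
(`eventuallyTorsionExt_LClassModule`). -/

open CategoryTheory.Abelian in
/-- An object `V` has eventually torsion `Ext` if some positive integer annihilates `Ext V Y n`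
for all `Y` and all sufficiently large `n`. -/
def EventuallyTorsionExt {C : Type*} [Category* C] [Abelian C] [HasExt.{w} C] (V : C) : Prop :=
  ∃ N m : ℕ, 0 < m ∧ ∀ n, N ≤ n → ∀ (Y : C) (x : Ext.{w} V Y n), m • x = 0

/-! ### Closure properties of modules with eventually torsion Ext. -/

namespace EventuallyTorsionExt

open CategoryTheory.Abelian

section Abelian

variable {C : Type*} [Category* C] [Abelian C] [HasExt.{w} C]

lemma of_projective (V : C) [Projective V] : EventuallyTorsionExt.{w} V := by
  refine ⟨1, 1, one_pos, fun n hn Y x => ?_⟩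
  obtain ⟨n, rfl⟩ : ∃ k, n = k + 1 := ⟨n - 1, by omega⟩
  rw [one_smul]
  exact x.eq_zero_of_projective

/-- m • x is the pullback along f of the pullback of x along g; the latter is a class on W, killed
by k in large degrees. -/
lemma of_retract {V W : C} (f : V ⟶ W) (g : W ⟶ V) {m : ℕ} (hm : 0 < m) (h : f ≫ g = m • 𝟙 V)
    (hW : EventuallyTorsionExt.{w} W) : EventuallyTorsionExt.{w} V := by
  obtain ⟨N, k, hk, hN⟩ := hW
  refine ⟨N, k * m, Nat.mul_pos hk hm, fun n hn Y x => ?_⟩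
  have h1 : (Ext.mk₀ f).comp ((Ext.mk₀ g).comp x (zero_add n)) (zero_add n) = m • x := by
    have h2 : Ext.mk₀ (m • 𝟙 V) = m • Ext.mk₀ (𝟙 V) :=
      map_nsmul (Ext.addEquiv₀ (X := V) (Y := V)).symm m (𝟙 V)
    have h3 : (m • Ext.mk₀ (𝟙 V)).comp x (zero_add n)
        = m • (Ext.mk₀ (𝟙 V)).comp x (zero_add n) :=
      map_nsmul (Ext.postcomp x V (zero_add n)) m _
    rw [Ext.mk₀_comp_mk₀_assoc, h, h2, h3, Ext.mk₀_id_comp]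
  have h4 := map_nsmul ((Ext.mk₀ f).precomp Y (zero_add n)) k
    ((Ext.mk₀ g).comp x (zero_add n))
  rw [hN n hn, map_zero] at h4
  rw [mul_smul, ← h1]
  exact h4.symm

lemma of_iso {V W : C} (e : V ≅ W) (hW : EventuallyTorsionExt.{w} W) :
    EventuallyTorsionExt.{w} V :=
  of_retract e.hom e.inv one_pos (by simp) hW

variable {S : ShortComplex C}

/-- By the long exact sequence, m₁ • x restricts to zero on X₁, hence comes from a class on X₃,
which m₃ kills. -/
lemma middle (hS : S.ShortExact) (h₁ : EventuallyTorsionExt.{w} S.X₁)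
    (h₃ : EventuallyTorsionExt.{w} S.X₃) : EventuallyTorsionExt.{w} S.X₂ := by
  obtain ⟨N₁, m₁, hm₁, h₁⟩ := h₁
  obtain ⟨N₃, m₃, hm₃, h₃⟩ := h₃
  refine ⟨max N₁ N₃, m₃ * m₁, Nat.mul_pos hm₃ hm₁, fun n hn Y x => ?_⟩
  obtain ⟨y, hy⟩ := Ext.contravariant_sequence_exact₂ hS Y (m₁ • x)
    ((map_nsmul ((Ext.mk₀ S.f).precomp Y (zero_add n)) m₁ x).trans (h₁ n (by omega) Y _))
  rw [mul_smul, ← hy]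
  exact (map_nsmul ((Ext.mk₀ S.g).precomp Y (zero_add n)) m₃ y).symm.trans
    (by rw [h₃ n (by omega) Y y, map_zero])

/-- Here m₂ • x comes from X₁ through the connecting map, which raises degree by one; hence the
bound 1 + N₁. -/
lemma right (hS : S.ShortExact) (h₁ : EventuallyTorsionExt.{w} S.X₁)
    (h₂ : EventuallyTorsionExt.{w} S.X₂) : EventuallyTorsionExt.{w} S.X₃ := by
  obtain ⟨N₁, m₁, hm₁, h₁⟩ := h₁
  obtain ⟨N₂, m₂, hm₂, h₂⟩ := h₂
  refine ⟨max (1 + N₁) N₂, m₁ * m₂, Nat.mul_pos hm₁ hm₂, fun n hn Y x => ?_⟩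
  obtain ⟨y, hy⟩ := Ext.contravariant_sequence_exact₃ hS Y (m₂ • x)
    ((map_nsmul ((Ext.mk₀ S.g).precomp Y (zero_add n)) m₂ x).trans (h₂ n (by omega) Y _))
    (n₀ := n - 1) (by omega)
  rw [mul_smul, ← hy]
  exact (map_nsmul (hS.extClass.precomp Y (by omega : 1 + (n - 1) = n)) m₁ y).symm.trans
    (by rw [h₁ (n - 1) (by omega) Y y, map_zero])

/-- If `Ext` out of `V` is eventually torsion, then in large degrees a positive multiple of the
identity of any projective resolution of `V` is null-homotopic. -/
lemma exists_homotopy {V : C} (hV : EventuallyTorsionExt.{w} V) :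
    ∃ N m : ℕ, 0 < m ∧ ∀ (P : ProjectiveResolution V) (n : ℕ), N ≤ n →
      ∃ (s : P.complex.X n ⟶ P.complex.X (n + 1)) (t : P.complex.X (n + 1) ⟶ P.complex.X (n + 2)),
        P.complex.d (n + 1) n ≫ s + t ≫ P.complex.d (n + 2) (n + 1) = m • 𝟙 _ := by
  obtain ⟨N, m, hm, h⟩ := hV
  refine ⟨N, m, hm, fun P n hn => ?_⟩
  have := P.projective
  let d := P.complex.d (n + 1) n
  -- q is a cocycle, giving a class in Ext^(n+1)(V, im d). As m kills it, m • q extends along d to a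
  -- map g on degree n. The target im d varies with P and n, so m must be uniform in the second
  -- argument of Ext.
  let q := Abelian.factorThruImage d
  have hq : q ≫ Abelian.image.ι d = d := Abelian.image.fac d
  have hdq : P.complex.d (n + 2) (n + 1) ≫ q = 0 := by
    rw [← cancel_mono (Abelian.image.ι d), Category.assoc, hq, Limits.zero_comp,
      P.complex.d_comp_d]
  have hmul : ∀ k : ℕ, P.complex.d (n + 2) (n + 1) ≫ (k • q) = 0 := fun k => by
    rw [Preadditive.comp_nsmul, hdq, smul_zero]
  have hsmul : ∀ k : ℕ, P.extMk (k • q) (n + 2) rfl (hmul k)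
      = k • P.extMk q (n + 2) rfl hdq := by
    intro k
    induction k with
    | zero => simp
    | succ k ih =>
      rw [succ_nsmul (P.extMk q _ _ hdq), ← ih, P.add_extMk]
      simp only [succ_nsmul]
  obtain ⟨g, hg⟩ := (P.extMk_eq_zero_iff (m • q) (n + 2) rfl (hmul m) n rfl).1
    (by rw [hsmul, h (n + 1) (by omega)])
  -- Lifting g through q makes m • 1 - d ≫ s land in the kernel of d, so exactness lifts this
  -- difference to t.
  let s := Projective.factorThru g q
  have hs : s ≫ q = g := Projective.factorThru_comp g q
  have hz : (m • 𝟙 (P.complex.X (n + 1)) - P.complex.d (n + 1) n ≫ s) ≫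
      P.complex.d (n + 1) n = 0 := by
    have : (m • 𝟙 (P.complex.X (n + 1)) - P.complex.d (n + 1) n ≫ s) ≫ q = 0 := by
      rw [Preadditive.sub_comp, Category.assoc, hs, hg, Preadditive.nsmul_comp,
        Category.id_comp, sub_self]
    change _ ≫ d = 0
    rw [← hq, ← Category.assoc, this, Limits.zero_comp]
  refine ⟨s, (P.exact_succ n).liftFromProjective _ hz, ?_⟩
  have := (P.exact_succ n).liftFromProjective_comp _ hz
  dsimp only at this
  rw [this]
  abel

end Abelian

section Module

variable {R : Type u} [Ring R]

lemma of_linearMap_comp {V W : Type u} [AddCommGroup V] [Module R V] [AddCommGroup W] [Module R W]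
    (f : V →ₗ[R] W) (g : W →ₗ[R] V) {m : ℕ} (hm : 0 < m) (h : ∀ v, g (f v) = m • v)
    (hW : EventuallyTorsionExt (ModuleCat.of R W)) :
    EventuallyTorsionExt (ModuleCat.of R V) :=
  of_retract (ModuleCat.ofHom f) (ModuleCat.ofHom g) hm
    (ModuleCat.hom_ext (LinearMap.ext fun v => by simpa using h v)) hW

lemma of_linearEquiv {V W : Type u} [AddCommGroup V] [Module R V] [AddCommGroup W] [Module R W]
    (e : V ≃ₗ[R] W) (hW : EventuallyTorsionExt (ModuleCat.of R W)) :
    EventuallyTorsionExt (ModuleCat.of R V) :=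
  of_iso e.toModuleIso hW

lemma of_module_projective (V : Type u) [AddCommGroup V] [Module R V] [Module.Projective R V] :
    EventuallyTorsionExt (ModuleCat.of R V) :=
  have := (IsProjective.iff_projective V).1 ‹_›
  of_projective _

lemma of_subsingleton (V : Type u) [AddCommGroup V] [Module R V] [Subsingleton V] :
    EventuallyTorsionExt (ModuleCat.of R V) :=
  of_module_projective V

variable {U V W : Type u} [AddCommGroup U] [Module R U] [AddCommGroup V] [Module R V]
  [AddCommGroup W] [Module R W] {f : U →ₗ[R] V} {g : V →ₗ[R] W}

lemma of_exact_middle (hf : Function.Injective f) (hg : Function.Surjective g)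
    (h : Function.Exact f g) (hU : EventuallyTorsionExt (ModuleCat.of R U))
    (hW : EventuallyTorsionExt (ModuleCat.of R W)) :
    EventuallyTorsionExt (ModuleCat.of R V) :=
  middle (ModuleCat.shortComplex_shortExact
    (ShortComplex.mk (ModuleCat.ofHom f) (ModuleCat.ofHom g)
      (ModuleCat.hom_ext h.linearMap_comp_eq_zero)) h hf hg) hU hW

lemma of_exact_right (hf : Function.Injective f) (hg : Function.Surjective g)
    (h : Function.Exact f g) (hU : EventuallyTorsionExt (ModuleCat.of R U))
    (hV : EventuallyTorsionExt (ModuleCat.of R V)) :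
    EventuallyTorsionExt (ModuleCat.of R W) :=
  right (ModuleCat.shortComplex_shortExact
    (ShortComplex.mk (ModuleCat.ofHom f) (ModuleCat.ofHom g)
      (ModuleCat.hom_ext h.linearMap_comp_eq_zero)) h hf hg) hU hV

lemma pi_fin (hV : EventuallyTorsionExt (ModuleCat.of R V)) (n : ℕ) :
    EventuallyTorsionExt (ModuleCat.of R (Fin n → V)) := by
  induction n with
  | zero => exact of_subsingleton _
  | succ n ih =>
    refine of_linearEquiv (Fin.consLinearEquiv R fun _ => V).symm ?_
    exact of_exact_middle (f := LinearMap.inl R V (Fin n → V)) (g := LinearMap.snd R V (Fin n → V))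
      LinearMap.inl_injective LinearMap.snd_surjective Function.Exact.inl_snd hV ih

lemma of_submodule_of_quotient (K : Submodule R V) (hK : EventuallyTorsionExt (ModuleCat.of R K))
    (hQ : EventuallyTorsionExt (ModuleCat.of R (V ⧸ K))) :
    EventuallyTorsionExt (ModuleCat.of R V) :=
  of_exact_middle K.injective_subtype K.mkQ_surjective (LinearMap.exact_subtype_mkQ K) hK hQ

lemma quotient (K : Submodule R V) (hK : EventuallyTorsionExt (ModuleCat.of R K))
    (hV : EventuallyTorsionExt (ModuleCat.of R V)) :
    EventuallyTorsionExt (ModuleCat.of R (V ⧸ K)) :=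
  of_exact_right K.injective_subtype K.mkQ_surjective (LinearMap.exact_subtype_mkQ K) hK hV

/-- A linear map out of a module with eventually torsion `Ext` whose kernel and cokernel have
eventually torsion `Ext` has target with eventually torsion `Ext`. -/
lemma of_linearMap (f : U →ₗ[R] V) (hU : EventuallyTorsionExt (ModuleCat.of R U))
    (hK : EventuallyTorsionExt (ModuleCat.of R (LinearMap.ker f)))
    (hQ : EventuallyTorsionExt (ModuleCat.of R (V ⧸ LinearMap.range f))) :
    EventuallyTorsionExt (ModuleCat.of R V) :=
  of_submodule_of_quotient _
    (of_linearEquiv f.quotKerEquivRange.symm (quotient _ hK hU)) hQ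

end Module

end EventuallyTorsionExt

/-! ### Resolutions by finitely generated projectives. -/

section FiniteResolution

variable {R : Type u} [Ring R]

/-- Finiteness is a conditional conclusion so that covers can be chosen for all modules at once; the
resolution is built recursively and its finiteness proved afterwards. -/
lemma ModuleCat.exists_projective_cover (V : ModuleCat.{u} R) :
    ∃ (Q : ModuleCat.{u} R) (p : Q ⟶ V), Projective Q ∧ Epi p ∧
      (Module.Finite R V → Module.Finite R Q) := by
  by_cases h : Module.Finite R V
  · obtain ⟨n, f, hf⟩ := Module.Finite.exists_fin' R V
    exact ⟨ModuleCat.of R (Fin n → R), ModuleCat.ofHom f,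
      (IsProjective.iff_projective _).1 inferInstance,
      (ModuleCat.epi_iff_surjective _).2 hf, fun _ => inferInstanceAs (Module.Finite R (Fin n → R))⟩
  · exact ⟨Projective.over V, Projective.π V, inferInstance, inferInstance, fun h' => absurd h' h⟩

/-- Over a Noetherian ring, a finitely generated module has a resolution by finitely generated
projective modules. -/
theorem ModuleCat.exists_projectiveResolution_finite [IsNoetherianRing R] (V : ModuleCat.{u} R)
    [hV : Module.Finite R V] :
    ∃ P : ProjectiveResolution V, ∀ n, Module.Finite R (P.complex.X n) := by
  choose Q p hQ hp hfin using ModuleCat.exists_projective_cover (R := R)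
  let succ : ∀ {X₀ X₁ : ModuleCat.{u} R} (f : X₁ ⟶ X₀),
      Σ' (X₂ : ModuleCat.{u} R) (d : X₂ ⟶ X₁), d ≫ f = 0 := fun f =>
    ⟨Q (Limits.kernel f), p (Limits.kernel f) ≫ Limits.kernel.ι f, by simp⟩
  have hker : ∀ {X Y : ModuleCat.{u} R} (f : X ⟶ Y), Module.Finite R X →
      Module.Finite R (Q (Limits.kernel f)) := by
    intro X Y f hX
    have : IsNoetherian R X := inferInstance
    exact hfin _ (Module.Finite.of_injective (Limits.kernel.ι f).hom
      ((ModuleCat.mono_iff_injective _).1 inferInstance))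
  have hexact : ∀ {X Y : ModuleCat.{u} R} (f : X ⟶ Y),
      (ShortComplex.mk (p (Limits.kernel f) ≫ Limits.kernel.ι f) f (by simp)).Exact := by
    intro X Y f
    let α : ShortComplex.mk (p (Limits.kernel f) ≫ Limits.kernel.ι f) f (by simp) ⟶
        ShortComplex.mk (Limits.kernel.ι f) f (by simp) :=
      { τ₁ := p _
        τ₂ := 𝟙 _
        τ₃ := 𝟙 _ }
    have : Epi α.τ₁ := hp _
    have : IsIso α.τ₂ := inferInstanceAs (IsIso (𝟙 X))
    have : Mono α.τ₃ := inferInstanceAs (Mono (𝟙 Y))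
    rw [ShortComplex.exact_iff_of_epi_of_isIso_of_mono α]
    exact ShortComplex.exact_of_f_is_kernel _ (Limits.kernelIsKernel f)
  let K : ChainComplex (ModuleCat.{u} R) ℕ :=
    ChainComplex.mk' (Q V) (Q (Limits.kernel (p V)))
      (p (Limits.kernel (p V)) ≫ Limits.kernel.ι (p V)) succ
  have hKd : K.d 1 0 = p (Limits.kernel (p V)) ≫ Limits.kernel.ι (p V) := by simp [K]
  let hKX : ∀ n, K.X (n + 2) ≅ Q (Limits.kernel (K.d (n + 1) n)) := fun n =>
    ChainComplex.mk'XIso _ _ _ succ n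
  have hproj : ∀ n, Projective (K.X n) := by
    intro n
    match n with
    | 0 => exact hQ _
    | 1 => exact hQ _
    | n + 2 => exact Projective.of_iso (hKX n).symm (hQ _)
  -- Each new term covers a kernel inside the preceding term, finitely generated by noetherianity;
  -- two consecutive degrees are carried along.
  have hKfin : ∀ n, Module.Finite R (K.X n) ∧ Module.Finite R (K.X (n + 1)) := by
    intro n
    induction n with
    | zero => exact ⟨hfin _ hV, hker _ (hfin _ hV)⟩
    | succ n ih =>
      have := hker (K.d (n + 1) n) ih.2
      exact ⟨ih.2, Module.Finite.equiv (hKX n).toLinearEquiv.symm⟩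
  have hKexact : ∀ n, K.ExactAt (n + 1) := by
    intro n
    rw [HomologicalComplex.exactAt_iff' _ (n + 1 + 1) (n + 1) n (by simp) (by simp)]
    have hd : K.d (n + 2) (n + 1) = (hKX n).hom ≫
        p (Limits.kernel (K.d (n + 1) n)) ≫ Limits.kernel.ι (K.d (n + 1) n) :=
      ChainComplex.mk'_d (Q V) (Q (Limits.kernel (p V)))
        (p (Limits.kernel (p V)) ≫ Limits.kernel.ι (p V)) succ n
    let e : ShortComplex.mk (p (Limits.kernel (K.d (n + 1) n)) ≫ Limits.kernel.ι _)
        (K.d (n + 1) n) (by simp) ≅ K.sc' (n + 1 + 1) (n + 1) n :=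
      ShortComplex.isoMk (hKX n).symm (Iso.refl (K.X (n + 1))) (Iso.refl (K.X n))
        (by
          change (hKX n).inv ≫ K.d (n + 2) (n + 1) = _ ≫ 𝟙 (K.X (n + 1))
          rw [hd, Iso.inv_hom_id_assoc, Category.comp_id])
        (by
          change 𝟙 (K.X (n + 1)) ≫ K.d (n + 1) n = K.d (n + 1) n ≫ 𝟙 (K.X n)
          rw [Category.id_comp, Category.comp_id])
    exact ShortComplex.exact_of_iso e (hexact (K.d (n + 1) n))
  have hzero : K.d 1 0 ≫ p V = 0 := by
    rw [hKd]
    change (p (Limits.kernel (p V)) ≫ Limits.kernel.ι (p V)) ≫ p V = 0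
    rw [Category.assoc, Limits.kernel.condition, Limits.comp_zero]
  let π : K ⟶ (ChainComplex.single₀ _).obj V :=
    (ChainComplex.toSingle₀Equiv _ _).symm ⟨p V, hzero⟩
  have hπ : QuasiIso π := ⟨fun n => by
    cases n
    · rw [ChainComplex.quasiIsoAt₀_iff, ShortComplex.quasiIso_iff_of_zeros']
      · refine (ShortComplex.exact_and_epi_g_iff_of_iso ?_).2
          ⟨hexact (p V), hp V⟩
        exact ShortComplex.isoMk (Iso.refl (K.X 1)) (Iso.refl (K.X 0)) (Iso.refl V)
          (by
            change 𝟙 (K.X 1) ≫ (p (Limits.kernel (p V)) ≫ Limits.kernel.ι (p V)) =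
              K.d 1 0 ≫ 𝟙 (K.X 0)
            rw [Category.comp_id, hKd]
            exact Category.id_comp (p (Limits.kernel (p V)) ≫ Limits.kernel.ι (p V)))
          (by
            change 𝟙 (K.X 0) ≫ p V = π.f 0 ≫ 𝟙 V
            have : π.f 0 = p V := ChainComplex.toSingle₀Equiv_symm_apply_f_zero _ _
            rw [this]
            exact (Category.id_comp (p V)).trans (Category.comp_id (p V)).symm)
      all_goals rfl
    · rw [quasiIsoAt_iff_exactAt']
      · apply hKexact
      · apply ChainComplex.exactAt_succ_single_obj⟩
  exact ⟨{ complex := K, projective := hproj, π := π, quasiIso := hπ }, fun n => (hKfin n).1⟩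

end FiniteResolution

/-- The homology of finitely generated abelian groups at a spot where a positive multiple of the
identity is null-homotopic is finite. -/
lemma AddCommGrpCat.finite_homology (S : ShortComplex AddCommGrpCat.{u}) [Module.Finite ℤ S.X₂]
    (s : S.X₃ ⟶ S.X₂) (t : S.X₂ ⟶ S.X₁) {m : ℕ} (hm : 0 < m)
    (h : S.g ≫ s + t ≫ S.f = m • 𝟙 S.X₂) : Finite S.homology := by
  suffices Finite (AddMonoidHom.ker S.g.hom ⧸ AddMonoidHom.range S.abToCycles) from
    Finite.of_equiv _ S.abHomologyIso.symm.addCommGroupIsoToAddEquiv.toEquiv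
  have hfin : Module.Finite ℤ (AddMonoidHom.ker S.g.hom) :=
    Module.Finite.of_injective (AddMonoidHom.ker S.g.hom).subtype.toIntLinearMap
      Subtype.val_injective
  have : Module.Finite ℤ (AddMonoidHom.ker S.g.hom ⧸ AddMonoidHom.range S.abToCycles) :=
    Module.Finite.of_surjective
      (QuotientAddGroup.mk' (AddMonoidHom.range S.abToCycles)).toIntLinearMap
      (QuotientAddGroup.mk'_surjective _)
  refine Module.finite_of_fg_torsion _ fun {x} => ?_
  obtain ⟨z, rfl⟩ := QuotientAddGroup.mk'_surjective _ x
  refine ⟨⟨m, mem_nonZeroDivisors_of_ne_zero (by exact_mod_cast hm.ne')⟩, ?_⟩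
  change (m : ℤ) • QuotientAddGroup.mk' (AddMonoidHom.range S.abToCycles) z = 0
  rw [natCast_zsmul, ← map_nsmul]
  -- On a cycle z the homotopy identity reads f (t z) = m • z, so m kills homology.
  refine (QuotientAddGroup.eq_zero_iff _).2 ⟨t.hom z.1, Subtype.ext ?_⟩
  have h1 := congrArg (fun φ => φ.hom z.1) h
  have hz : S.g.hom z.1 = 0 := z.2
  simpa [hz] using h1

/-! ### From torsion of Ext to finiteness of Tor. -/

namespace MonoidHomology

/-- The null-homotopy of m on the resolution survives the additive functor B ⊗_R -, whose values on
the terms are finitely generated over ℤ. -/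
theorem exists_forall_finite_TorGroup (R : Type u) [Ring R] (B : Type u) [AddCommGroup B]
    [Module Rᵐᵒᵖ B] [Module.Finite ℤ R] [Module.Finite ℤ B] (V : ModuleCat.{u} R)
    [Module.Finite R V] (hV : EventuallyTorsionExt V) :
    ∃ N : ℕ, ∀ n, N ≤ n → Finite (TorGroup.{u, u, u} R B V n) := by
  have : IsNoetherianRing R := isNoetherian_of_tower ℤ inferInstance
  obtain ⟨P, hP⟩ := ModuleCat.exists_projectiveResolution_finite V
  obtain ⟨N, m, hm, h⟩ := hV.exists_homotopy
  refine ⟨N + 1, fun n hn => ?_⟩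
  obtain ⟨n, rfl⟩ : ∃ k, n = k + 1 := ⟨n - 1, by omega⟩
  obtain ⟨s, t, hst⟩ := h P n (by omega)
  let F := tensorFunctor.{u, u, u} R B
  let K := (F.mapHomologicalComplex (ComplexShape.down ℕ)).obj P.complex
  have e : TorGroup.{u, u, u} R B V (n + 1) ≅ (K.sc' (n + 2) (n + 1) n).homology :=
    P.isoLeftDerivedObj F (n + 1) ≪≫ ShortComplex.homologyMapIso
      (K.isoSc' (n + 2) (n + 1) n (by simp) (by simp))
  have : Module.Finite ℤ (K.sc' (n + 2) (n + 1) n).X₂ := by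
    have hPR : Module.Finite R (P.complex.X (n + 1)) := hP (n + 1)
    have hPZ : Module.Finite ℤ (P.complex.X (n + 1)) := Module.Finite.trans R _
    have hT : Module.Finite ℤ (B ⊗[ℤ] P.complex.X (n + 1)) := Module.Finite.tensorProduct ℤ B _
    -- The tensor product has two ℤ-module structures, its own and that of its additive group; the
    -- quotient below uses the second.
    have hT' : @Module.Finite ℤ (B ⊗[ℤ] P.complex.X (n + 1)) _ _ (AddCommGroup.toIntModule _) := by
      convert hT
    exact Module.Finite.of_surjective
      (QuotientAddGroup.mk' (balancedRel R B (P.complex.X (n + 1)))).toIntLinearMap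
      (QuotientAddGroup.mk'_surjective _)
  have : Finite (K.sc' (n + 2) (n + 1) n).homology :=
    AddCommGrpCat.finite_homology _ (F.map s) (F.map t) hm (by
      have := congrArg (fun φ => F.map φ) hst
      simp only [F.map_add, F.map_comp, F.map_nsmul, F.map_id] at this
      exact this)
  exact Finite.of_equiv _ (e.symm.addCommGroupIsoToAddEquiv.toEquiv)

/-! ### The J-order and stability of finite monoids. -/

section Green

variable {M : Type*} [Monoid M]

/-- `a` lies in the principal two-sided ideal generated by `b`. -/
def JLE (a b : M) : Prop := ∃ p q : M, a = p * b * q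

lemma JLE.refl (a : M) : JLE a a := ⟨1, 1, by simp⟩

lemma JLE.trans {a b c : M} : JLE a b → JLE b c → JLE a c := by
  rintro ⟨p, q, rfl⟩ ⟨p', q', rfl⟩
  exact ⟨p * p', q' * q, by simp only [mul_assoc]⟩

lemma JLE.mul_left (p a : M) : JLE (p * a) a := ⟨p, 1, by simp⟩

lemma JLE.mul_right (a q : M) : JLE (a * q) a := ⟨1, q, by simp⟩

/-- The principal two-sided ideal generated by `a`. -/
def principalIdeal (a : M) : Set M := {x | JLE x a}

lemma principalIdeal_subset {a b : M} : principalIdeal a ⊆ principalIdeal b ↔ JLE a b :=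
  ⟨fun h => h (JLE.refl a), fun h _ hx => JLE.trans hx h⟩

lemma ncard_principalIdeal_le [Finite M] {a b : M} (h : JLE a b) :
    (principalIdeal a).ncard ≤ (principalIdeal b).ncard :=
  Set.ncard_le_ncard (principalIdeal_subset.2 h)

lemma JLE.of_ncard_le [Finite M] {a b : M} (h : JLE a b)
    (hc : (principalIdeal b).ncard ≤ (principalIdeal a).ncard) : JLE b a :=
  principalIdeal_subset.1
    (Set.eq_of_subset_of_ncard_le (principalIdeal_subset.2 h) hc).symm.subset

lemma ncard_principalIdeal_lt [Finite M] {a b : M} (h : JLE a b) (h' : ¬ JLE b a) :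
    (principalIdeal a).ncard < (principalIdeal b).ncard :=
  lt_of_not_ge fun hc => h' (h.of_ncard_le hc)

/-- Stability of finite monoids on the left. -/
lemma exists_eq_mul_left_of_JLE [Finite M] {x c : M} (h : JLE x (c * x)) :
    ∃ d, x = d * (c * x) := by
  obtain ⟨p, q, h⟩ := h
  -- Iterate x = (p c) x q. Since powers of p c repeat, the factor q can then be cancelled.
  have hk : ∀ k : ℕ, x = (p * c) ^ k * x * q ^ k := by
    intro k
    induction k with
    | zero => simp
    | succ k ih =>
      calc x = p * (c * x) * q := h
        _ = (p * c) * ((p * c) ^ k * x * q ^ k) * q := by rw [← ih]; simp only [mul_assoc]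
        _ = _ := by rw [pow_succ' (p * c), pow_succ q]; simp only [mul_assoc]
  obtain ⟨i, j, hij, hpow⟩ : ∃ i j : ℕ, i < j ∧ (p * c) ^ i = (p * c) ^ j := by
    obtain ⟨i, j, hne, h⟩ := Finite.exists_ne_map_eq_of_infinite (fun k : ℕ => (p * c) ^ k)
    rcases lt_or_gt_of_ne hne with hlt | hlt
    · exact ⟨i, j, hlt, h⟩
    · exact ⟨j, i, hlt, h.symm⟩
  obtain ⟨k, rfl⟩ : ∃ k, j = (k + 1) + i := ⟨j - i - 1, by omega⟩
  have hx : x = (p * c) ^ (k + 1) * x :=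
    calc x = (p * c) ^ (k + 1 + i) * x * q ^ i := by rw [← hpow]; exact hk i
      _ = (p * c) ^ (k + 1) * ((p * c) ^ i * x * q ^ i) := by rw [pow_add]; simp only [mul_assoc]
      _ = _ := by rw [← hk i]
  exact ⟨(p * c) ^ k * p, by
    conv_lhs => rw [hx, pow_succ]
    simp only [mul_assoc]⟩

/-- Stability of finite monoids on the right. -/
lemma exists_eq_mul_right_of_JLE [Finite M] {x c : M} (h : JLE x (x * c)) :
    ∃ d, x = x * c * d := by
  obtain ⟨p, q, h⟩ := h
  have : Finite Mᵐᵒᵖ := Finite.of_equiv M MulOpposite.opEquiv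
  obtain ⟨d, hd⟩ := exists_eq_mul_left_of_JLE (x := MulOpposite.op x) (c := MulOpposite.op c)
    ⟨MulOpposite.op q, MulOpposite.op p, by
      simp only [← MulOpposite.op_mul]
      rw [← mul_assoc]
      exact congrArg MulOpposite.op h⟩
  exact ⟨d.unop, congrArg MulOpposite.unop hd⟩

/-- The elements of the principal left ideal of `a` that lie strictly `J`-below `a`. -/
def lowerLeftIdeal (a : M) : Set M := {x | (∃ c, x = c * a) ∧ ¬ JLE a x}

/-- Closure under multiplication on the left by arbitrary elements. -/
def IsLeftIdeal (X : Set M) : Prop := ∀ a x, x ∈ X → a * x ∈ X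

lemma isLeftIdeal_range_mul (a : M) : IsLeftIdeal (Set.range (· * a)) := by
  rintro c _ ⟨d, rfl⟩
  exact ⟨c * d, mul_assoc _ _ _⟩

lemma lowerLeftIdeal_subset (a : M) : lowerLeftIdeal a ⊆ Set.range (· * a) := by
  rintro _ ⟨⟨d, rfl⟩, -⟩
  exact ⟨d, rfl⟩

end Green

/-! ### Modules spanned by left ideals of M, and their L-class layers. -/

section LeftIdealModule

open MonoidAlgebra

variable {M : Type u} [Monoid M]

/-- The left ideal of `ℤM` spanned by a subset of `M`. -/
noncomputable def spanOf (X : Set M) : Submodule (MonoidAlgebra ℤ M) (MonoidAlgebra ℤ M) :=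
  Submodule.span _ (of ℤ M '' X)

lemma of_mem_spanOf {X : Set M} {x : M} (hx : x ∈ X) : of ℤ M x ∈ spanOf X :=
  Submodule.subset_span ⟨x, hx, rfl⟩

lemma spanOf_mono {X Y : Set M} (h : X ⊆ Y) : spanOf X ≤ spanOf Y :=
  Submodule.span_mono (Set.image_mono h)

lemma spanOf_union (X Y : Set M) : spanOf (X ∪ Y) = spanOf X ⊔ spanOf Y := by
  rw [spanOf, Set.image_union, Submodule.span_union, spanOf, spanOf]

/-- The ℤ-span of a left ideal is already a left ideal of ℤM, so membership is a condition on
supports; this is what makes spans commute with intersections. -/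
lemma mem_spanOf {X : Set M} (hX : IsLeftIdeal X) {f : MonoidAlgebra ℤ M} :
    f ∈ spanOf X ↔ ∀ m ∈ f.coeff.support, m ∈ X := by
  refine mem_ideal_span_of_image.trans (forall₂_congr fun m _ => ⟨?_, fun h => ⟨m, h, 1, by simp⟩⟩)
  rintro ⟨m', h, d, rfl⟩
  exact hX d m' h

lemma spanOf_inter {X Y : Set M} (hX : IsLeftIdeal X) (hY : IsLeftIdeal Y) :
    spanOf (X ∩ Y) = spanOf X ⊓ spanOf Y := by
  have hXY : IsLeftIdeal (X ∩ Y) := fun a x hx => ⟨hX a x hx.1, hY a x hx.2⟩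
  ext f
  rw [mem_spanOf hXY, Submodule.mem_inf, mem_spanOf hX,
    mem_spanOf hY]
  exact forall₂_and

lemma spanOf_le_comap {X : Set M} {W : Type*} [AddCommGroup W] [Module (MonoidAlgebra ℤ M) W]
    (φ : MonoidAlgebra ℤ M →ₗ[MonoidAlgebra ℤ M] W) (N : Submodule (MonoidAlgebra ℤ M) W)
    (h : ∀ x ∈ X, φ (of ℤ M x) ∈ N) : spanOf X ≤ N.comap φ := by
  rw [spanOf, Submodule.span_le]
  rintro _ ⟨x, hx, rfl⟩
  exact h x hx

lemma mul_of_eq_self {e : M} {X : Set M} (h : ∀ x ∈ X, x * e = x) {f : MonoidAlgebra ℤ M}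
    (hf : f ∈ spanOf X) : f * of ℤ M e = f := by
  have h' : Set.EqOn (LinearMap.toSpanSingleton (MonoidAlgebra ℤ M) (MonoidAlgebra ℤ M) (of ℤ M e))
      (LinearMap.id (R := MonoidAlgebra ℤ M) (M := MonoidAlgebra ℤ M)) (spanOf X) := by
    refine LinearMap.eqOn_span ?_
    rintro _ ⟨x, hx, rfl⟩
    simp only [LinearMap.toSpanSingleton_apply, smul_eq_mul, ← map_mul, h x hx, LinearMap.id_apply]
  exact h' hf

lemma mul_of_mem_spanOf_range (e : M) (f : MonoidAlgebra ℤ M) :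
    f * of ℤ M e ∈ spanOf (Set.range (· * e)) :=
  Submodule.smul_mem _ f (of_mem_spanOf ⟨1, one_mul e⟩)

/-- The quotient of `ℤ[Ma]` by the span of the elements strictly `J`-below `a`. -/
abbrev LClassModule (a : M) : Type u :=
  spanOf (Set.range (· * a)) ⧸ (spanOf (lowerLeftIdeal a)).submoduleOf (spanOf (Set.range (· * a)))

/-- Peel off the L-class of a J-maximal a ∈ X. The rest Y satisfies X = Ma ∪ Y, and Ma ∩ Y is the
lower part of Ma, so ℤX / ℤY is the L-class module of a; induct on |X|. -/
theorem eventuallyTorsionExt_spanOf [Finite M] {X : Set M} (hX : IsLeftIdeal X)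
    (h : ∀ a ∈ X, EventuallyTorsionExt (ModuleCat.of (MonoidAlgebra ℤ M) (LClassModule a))) :
    EventuallyTorsionExt (ModuleCat.of (MonoidAlgebra ℤ M) (spanOf X)) := by
  induction hn : X.ncard using Nat.strong_induction_on generalizing X with
  | _ n ih =>
  rcases X.eq_empty_or_nonempty with rfl | hne
  · have : Subsingleton (spanOf (∅ : Set M)) := by
      rw [spanOf, Set.image_empty, Submodule.span_empty]
      infer_instance
    exact .of_subsingleton _
  obtain ⟨a, ha, hmax⟩ := X.toFinite.exists_maximalFor (fun a => (principalIdeal a).ncard) X hne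
  let Y : Set M := {x ∈ X | ¬ ((∃ c, x = c * a) ∧ JLE a x)}
  -- If c x falls into the L-class of a, maximality puts x in the same J-class, and stability gives
  -- x ∈ M c x ⊆ M a.
  have hY : IsLeftIdeal Y := by
    rintro c x ⟨hx, hxa⟩
    refine ⟨hX c x hx, fun ⟨⟨d, hd⟩, hJ⟩ => hxa ?_⟩
    have hax : JLE a x := hJ.trans (JLE.mul_left _ _)
    have hxa' : JLE x a := hax.of_ncard_le (hmax hx (ncard_principalIdeal_le hax))
    obtain ⟨d', hd'⟩ := exists_eq_mul_left_of_JLE (hxa'.trans hJ)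
    exact ⟨⟨d' * d, by rw [hd', hd, mul_assoc]⟩, hax⟩
  have hYX : Y ⊆ X := fun x hx => hx.1
  have haY : a ∉ Y := fun h => h.2 ⟨⟨1, by simp⟩, JLE.refl a⟩
  have hcard : Y.ncard < n := hn ▸ Set.ncard_lt_ncard ⟨hYX, fun h => haY (h ha)⟩
  have hYgood := ih _ hcard hY (fun b hb => h b (hYX hb)) rfl
  have hunion : Set.range (· * a) ∪ Y = X := by
    ext x
    constructor
    · rintro (⟨c, rfl⟩ | hx)
      · exact hX c a ha
      · exact hx.1
    · intro hx
      by_cases hxa : (∃ c, x = c * a) ∧ JLE a x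
      · obtain ⟨⟨c, rfl⟩, -⟩ := hxa
        exact Or.inl ⟨c, rfl⟩
      · exact Or.inr ⟨hx, hxa⟩
  have hinter : Set.range (· * a) ∩ Y = lowerLeftIdeal a := by
    ext x
    constructor
    · rintro ⟨⟨c, rfl⟩, hx⟩
      exact ⟨⟨c, rfl⟩, fun hJ => hx.2 ⟨⟨c, rfl⟩, hJ⟩⟩
    · rintro ⟨⟨c, rfl⟩, hx⟩
      exact ⟨⟨c, rfl⟩, hX c a ha, fun hJ => hx hJ.2⟩
  have e := LinearMap.quotientInfEquivSupQuotient (spanOf (Set.range (· * a))) (spanOf Y)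
  rw [← Submodule.comap_inf, ← spanOf_inter (isLeftIdeal_range_mul a) hY, hinter,
    ← spanOf_union, hunion] at e
  exact .of_submodule_of_quotient ((spanOf Y).submoduleOf (spanOf X))
    (.of_linearEquiv (Submodule.submoduleOfEquivOfLe (spanOf_mono hYX)) hYgood)
    (.of_linearEquiv e.symm (h a ha))

/-- The module `ℤ[Me]`, for an idempotent `e`, is projective. -/
lemma projective_spanOf_range_mul {e : M} (he : e * e = e) :
    Module.Projective (MonoidAlgebra ℤ M) (spanOf (Set.range (· * e))) := by
  let φ := LinearMap.toSpanSingleton (MonoidAlgebra ℤ M) (MonoidAlgebra ℤ M) (of ℤ M e)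
  refine Module.Projective.of_split (spanOf (Set.range (· * e))).subtype
    (φ.codRestrict _ fun f => ?_) ?_
  · exact mul_of_mem_spanOf_range e f
  · ext ⟨f, hf⟩ : 2
    refine mul_of_eq_self ?_ hf
    rintro _ ⟨x, rfl⟩
    simp only [mul_assoc, he]

/-- Regularity gives an idempotent e = t a with Ma = Me, so ℤ[Me] is projective. The submodule
divided out is a retract of ℤI, where I is the set of elements strictly J-below e, and the layers of
ℤI are good by induction. -/
theorem eventuallyTorsionExt_LClassModule [Finite M] (hM : IsRegularSemigroup M) (a : M) :
    EventuallyTorsionExt (ModuleCat.of (MonoidAlgebra ℤ M) (LClassModule a)) := by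
  induction hn : (principalIdeal a).ncard using Nat.strong_induction_on generalizing a with
  | _ n ih =>
  obtain ⟨t, ht⟩ := hM a
  set e := t * a with he
  have hae : a * e = a := by rw [he, ← mul_assoc, ht]
  have hee : e * e = e := by rw [he, mul_assoc, ← he, hae]
  have hJea : JLE e a := JLE.mul_left t a
  have hJae : JLE a e := by
    conv_lhs => rw [← hae]
    exact JLE.mul_left a e
  have hrange : Set.range (· * a) = Set.range (· * e) := by
    ext x
    constructor
    · rintro ⟨c, rfl⟩
      exact ⟨c * a, by simp only [mul_assoc, hae]⟩
    · rintro ⟨c, rfl⟩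
      exact ⟨c * t, by simp only [mul_assoc, he]⟩
  have hlower : lowerLeftIdeal a = lowerLeftIdeal e := by
    ext x
    have h1 : (∃ c, x = c * a) ↔ ∃ c, x = c * e := by
      have := Set.ext_iff.1 hrange x
      simpa [eq_comm] using this
    have h2 : JLE a x ↔ JLE e x := ⟨hJea.trans, hJae.trans⟩
    exact and_congr h1 (not_congr h2)
  let I : Set M := {x | JLE x e ∧ ¬ JLE e x}
  have hI : IsLeftIdeal I := fun c x hx =>
    ⟨(JLE.mul_left c x).trans hx.1, fun h => hx.2 (h.trans (JLE.mul_left c x))⟩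
  have hIgood := eventuallyTorsionExt_spanOf hI fun b hb =>
    ih _ (hn ▸ ncard_principalIdeal_lt (hb.1.trans hJea) fun h => hb.2 (hJea.trans h)) b rfl
  have hBI : lowerLeftIdeal e ⊆ I := by
    rintro _ ⟨⟨c, rfl⟩, h⟩
    exact ⟨JLE.mul_left c e, h⟩
  let φ := LinearMap.toSpanSingleton (MonoidAlgebra ℤ M) (MonoidAlgebra ℤ M) (of ℤ M e)
  -- Right multiplication by e carries I into the lower part of Me and fixes that part pointwise:
  -- this is the retraction.
  have hφ : spanOf I ≤ (spanOf (lowerLeftIdeal e)).comap φ := spanOf_le_comap φ _ fun x hx => by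
    simp only [φ, LinearMap.toSpanSingleton_apply, smul_eq_mul, ← map_mul]
    exact of_mem_spanOf ⟨⟨x, rfl⟩, fun h => hx.2 (h.trans (JLE.mul_right x e))⟩
  have hB : EventuallyTorsionExt
      (ModuleCat.of (MonoidAlgebra ℤ M) (spanOf (lowerLeftIdeal e))) := by
    refine .of_linearMap_comp (Submodule.inclusion (spanOf_mono hBI))
      (φ.restrict hφ : spanOf I →ₗ[MonoidAlgebra ℤ M] spanOf (lowerLeftIdeal e)) one_pos ?_ hIgood
    rintro ⟨f, hf⟩
    rw [one_smul]
    refine Subtype.ext ?_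
    refine mul_of_eq_self ?_ hf
    rintro _ ⟨⟨x, rfl⟩, -⟩
    simp only [mul_assoc, hee]
  have := projective_spanOf_range_mul hee
  unfold LClassModule
  rw [hrange, hlower]
  exact .quotient _
    (.of_linearEquiv (Submodule.submoduleOfEquivOfLe (spanOf_mono (lowerLeftIdeal_subset e))) hB)
    (.of_module_projective _)

end LeftIdealModule

end MonoidHomology

/-- Up to a positive multiple, a finitely generated abelian group is a retract of a free one. -/
lemma Module.Finite.exists_int_retract (W : Type*) [AddCommGroup W] [Module.Finite ℤ W] :
    ∃ (r m : ℕ) (α : W →ₗ[ℤ] (Fin r → ℤ)) (β : (Fin r → ℤ) →ₗ[ℤ] W), 0 < m ∧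
      ∀ w, β (α w) = m • w := by
  have : AddGroup.FG W := Module.Finite.iff_addGroup_fg.1 inferInstance
  obtain ⟨r, ι, _, p, hp, e, ⟨φ⟩⟩ := AddCommGroup.equiv_free_prod_directSum_zmod W
  have hm : 0 < ∏ i, p i ^ e i := Finset.prod_pos fun i _ => pow_pos (hp i).pos _
  have hkill : ∀ d : DirectSum ι fun i => ZMod (p i ^ e i), (∏ i, p i ^ e i) • d = 0 := by
    intro d
    refine DFinsupp.ext fun i => ?_
    change (∏ i, p i ^ e i) • d i = 0
    obtain ⟨k, hk⟩ := Finset.dvd_prod_of_mem (fun i => p i ^ e i) (Finset.mem_univ i)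
    rw [hk, nsmul_eq_mul]
    simp
  let m := ∏ i, p i ^ e i
  let α : W →+ (Fin r → ℤ) :=
    (Finsupp.linearEquivFunOnFinite ℤ ℤ (Fin r)).toAddEquiv.toAddMonoidHom.comp
      ((AddMonoidHom.fst _ _).comp φ.toAddMonoidHom)
  -- With the factor m in β, the composite is m on the free summand and 0, which is also m, on the
  -- torsion summand.
  let β : (Fin r → ℤ) →+ W := m • φ.symm.toAddMonoidHom.comp ((AddMonoidHom.inl _ _).comp
    (Finsupp.linearEquivFunOnFinite ℤ ℤ (Fin r)).symm.toAddEquiv.toAddMonoidHom)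
  refine ⟨r, m, α.toIntLinearMap, β.toIntLinearMap, hm, fun w => ?_⟩
  obtain ⟨⟨x, d⟩, rfl⟩ := φ.symm.surjective w
  have h1 : α (φ.symm (x, d)) = Finsupp.linearEquivFunOnFinite ℤ ℤ (Fin r) x := by
    simp [α]
  have h2 : β (Finsupp.linearEquivFunOnFinite ℤ ℤ (Fin r) x) = m • φ.symm (x, 0) := by
    simp [β]
  change β (α (φ.symm (x, d))) = _
  rw [h1, h2, ← map_nsmul, ← map_nsmul, Prod.smul_mk, Prod.smul_mk, hkill d, smul_zero]

/-! ### Tensoring with a finitely generated abelian group. -/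

namespace EventuallyTorsionExt

variable {R : Type u} [Ring R]

/-- Tensoring W → ℤ^r → W with S factors m times the identity of S ⊗ W through S^r. -/
lemma tensorProduct {S : Type u} [AddCommGroup S] [Module R S]
    (hS : EventuallyTorsionExt (ModuleCat.of R S)) (W : Type u) [AddCommGroup W]
    [Module.Finite ℤ W] : EventuallyTorsionExt (ModuleCat.of R (S ⊗[ℤ] W)) := by
  obtain ⟨r, m, α, β, hm, h⟩ := Module.Finite.exists_int_retract W
  let ρ := TensorProduct.AlgebraTensorModule.rid ℤ R S
  let α' : S ⊗[ℤ] W →ₗ[R] (Fin r → S) := LinearMap.pi fun i =>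
    ρ.toLinearMap ∘ₗ TensorProduct.AlgebraTensorModule.map LinearMap.id (LinearMap.proj i ∘ₗ α)
  let β' : (Fin r → S) →ₗ[R] S ⊗[ℤ] W := ∑ i, TensorProduct.AlgebraTensorModule.map LinearMap.id
    (LinearMap.toSpanSingleton ℤ W (β (Pi.single i 1))) ∘ₗ ρ.symm.toLinearMap ∘ₗ LinearMap.proj i
  refine of_linearMap_comp α' β' hm (fun t => ?_) (pi_fin hS r)
  induction t with
  | zero => simp
  | tmul s w =>
    have h1 : ∀ i, α' (s ⊗ₜ w) i = α w i • s := fun i => by simp [α', ρ]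
    have h2 : ∀ x : Fin r → S, β' x = ∑ i, x i ⊗ₜ β (Pi.single i 1) := fun x => by
      simp [β', ρ]
    have h3 : β (α w) = ∑ i, α w i • β (Pi.single i 1) := by
      conv_lhs => rw [pi_eq_sum_univ' (α w)]
      simp only [map_sum, map_smul]
    simp only [h2, h1, TensorProduct.smul_tmul]
    rw [← TensorProduct.tmul_sum, ← h3, h]
    exact TensorProduct.tmul_smul m s w
  | add x y hx hy => rw [map_add, map_add, hx, hy, smul_add]

end EventuallyTorsionExt

/-! ### The maximal subgroup at an idempotent. -/

namespace MonoidHomology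

open MonoidAlgebra

variable {M : Type u} [Monoid M]

/-- The units of the monoid `eMe`, each together with its inverse. -/
@[ext]
structure CornerUnit (e : M) where
  /-- the unit -/
  val : M
  /-- its inverse -/
  inv : M
  mul_val : e * val = val
  val_mul : val * e = val
  mul_inv : e * inv = inv
  inv_mul : inv * e = inv
  val_mul_inv : val * inv = e
  inv_mul_val : inv * val = e

namespace CornerUnit

variable {e : M}

instance [Finite M] : Finite (CornerUnit e) :=
  Finite.of_injective (fun g : CornerUnit e => (g.val, g.inv)) fun _ _ hgh =>
    CornerUnit.ext (congrArg Prod.fst hgh) (congrArg Prod.snd hgh)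

noncomputable instance [Finite M] : Fintype (CornerUnit e) := Fintype.ofFinite _

/-- The inverse of a unit of `eMe`. -/
def symm (g : CornerUnit e) : CornerUnit e :=
  ⟨g.inv, g.val, g.mul_inv, g.inv_mul, g.mul_val, g.val_mul, g.inv_mul_val, g.val_mul_inv⟩

/-- The product of two units of `eMe`. -/
def mul (g h : CornerUnit e) : CornerUnit e where
  val := g.val * h.val
  inv := h.inv * g.inv
  mul_val := by rw [← mul_assoc, g.mul_val]
  val_mul := by rw [mul_assoc, h.val_mul]
  mul_inv := by rw [← mul_assoc, h.mul_inv]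
  inv_mul := by rw [mul_assoc, g.inv_mul]
  val_mul_inv := by rw [mul_assoc, ← mul_assoc h.val, h.val_mul_inv, g.mul_inv, g.val_mul_inv]
  inv_mul_val := by rw [mul_assoc, ← mul_assoc g.inv, g.inv_mul_val, h.mul_val, h.inv_mul_val]

lemma symm_mul_mul (g h : CornerUnit e) : g.symm.mul (g.mul h) = h :=
  CornerUnit.ext (by simp [symm, mul, ← mul_assoc, g.inv_mul_val, h.mul_val])
    (by simp [symm, mul, mul_assoc, g.inv_mul_val, h.inv_mul])

/-- Left multiplication by a unit of `eMe`. -/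
def mulLeft (g : CornerUnit e) : CornerUnit e ≃ CornerUnit e where
  toFun := g.mul
  invFun := g.symm.mul
  left_inv := g.symm_mul_mul
  right_inv := g.symm.symm_mul_mul

lemma card_pos [Finite M] (he : e * e = e) : 0 < Fintype.card (CornerUnit e) :=
  Fintype.card_pos_iff.2 ⟨⟨e, e, he, he, he, he, he, he⟩⟩

/-- In a finite monoid, an element of `eMe` generating the same two-sided ideal as `e` is a unit
of `eMe`. -/
lemma exists_of_JLE [Finite M] {x : M} (h₁ : e * x = x) (h₂ : x * e = x) (h : JLE e x)
    (he : e * e = e) : ∃ g : CornerUnit e, g.val = x := by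
  -- Stability yields one-sided inverses d and d' of x; compressed to eMe they coincide.
  obtain ⟨d, hd⟩ := exists_eq_mul_left_of_JLE (x := e) (c := x) (by rwa [h₂])
  obtain ⟨d', hd'⟩ := exists_eq_mul_right_of_JLE (x := e) (c := x) (by rwa [h₁])
  rw [h₂] at hd
  rw [h₁] at hd'
  have hl : e * d * e * x = e := by rw [mul_assoc (e * d), h₁, mul_assoc e d, ← hd, he]
  have hr : x * (e * d' * e) = e := by
    rw [← mul_assoc, ← mul_assoc, h₂, ← hd', he]
  have heq : e * d * e = e * d' * e :=
    calc e * d * e = e * d * e * (x * (e * d' * e)) := by rw [hr, mul_assoc (e * d), he]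
      _ = e * (e * d' * e) := by rw [← mul_assoc, hl]
      _ = e * d' * e := by simp only [← mul_assoc, he]
  exact ⟨⟨x, e * d * e, h₁, h₂, by simp only [← mul_assoc, he], by rw [mul_assoc (e * d), he],
    by rw [heq, hr], hl⟩, rfl⟩

end CornerUnit

/-! ### The L-class module of an idempotent as a cyclic module with a right group action. -/

namespace LClassModule

/-- The class of `e`. -/
noncomputable def gen (e : M) : LClassModule e :=
  Submodule.Quotient.mk ⟨of ℤ M e, of_mem_spanOf ⟨1, one_mul e⟩⟩

variable {e : M}

lemma exists_eq_smul_gen (he : e * e = e) (s : LClassModule e) :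
    ∃ f : MonoidAlgebra ℤ M, s = f • gen e := by
  obtain ⟨⟨f, hf⟩, rfl⟩ := Submodule.Quotient.mk_surjective _ s
  refine ⟨f, congrArg Submodule.Quotient.mk (Subtype.ext (mul_of_eq_self ?_ hf).symm)⟩
  rintro _ ⟨x, rfl⟩
  simp only [mul_assoc, he]

lemma smul_gen_eq_zero (he : e * e = e) {x : M} (hx : x ∈ lowerLeftIdeal e) :
    of ℤ M x • gen e = 0 := by
  refine (Submodule.Quotient.mk_eq_zero _).2 ?_
  change of ℤ M x * of ℤ M e ∈ spanOf (lowerLeftIdeal e)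
  obtain ⟨⟨c, rfl⟩, h⟩ := hx
  rw [← map_mul, mul_assoc, he]
  exact of_mem_spanOf ⟨⟨c, rfl⟩, h⟩

lemma of_smul_gen (he : e * e = e) : of ℤ M e • gen e = gen e :=
  congrArg Submodule.Quotient.mk (Subtype.ext (by
    change of ℤ M e * of ℤ M e = of ℤ M e
    rw [← map_mul, he]))

variable {Z : Type*} [AddCommGroup Z] [Module (MonoidAlgebra ℤ M) Z]

/-- The linear map out of `LClassModule e` acting on a given element `z` that is killed by all
elements of `Me` strictly below `e`; it sends the class of `e` to `e z`. -/
noncomputable def lift (z : Z) (hz : ∀ x ∈ lowerLeftIdeal e, of ℤ M x • z = 0) :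
    LClassModule e →ₗ[MonoidAlgebra ℤ M] Z :=
  Submodule.liftQ _ ((LinearMap.toSpanSingleton (MonoidAlgebra ℤ M) Z z).comp
    (spanOf (Set.range (· * e))).subtype) (by
      rintro ⟨f, _⟩ hf
      exact spanOf_le_comap (LinearMap.toSpanSingleton (MonoidAlgebra ℤ M) Z z) ⊥ hz hf)

lemma lift_gen (z : Z) (hz : ∀ x ∈ lowerLeftIdeal e, of ℤ M x • z = 0)
    (hez : of ℤ M e • z = z) : lift z hz (gen e) = z := hez

lemma tensor_hom_ext (he : e * e = e) {W : Type*} [AddCommGroup W]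
    {f g : LClassModule e ⊗[ℤ] W →ₗ[MonoidAlgebra ℤ M] Z}
    (h : ∀ w, f (gen e ⊗ₜ w) = g (gen e ⊗ₜ w)) : f = g := by
  refine TensorProduct.AlgebraTensorModule.ext fun s w => ?_
  obtain ⟨a, rfl⟩ := exists_eq_smul_gen he s
  rw [← TensorProduct.smul_tmul', map_smul, map_smul, h]

instance [Finite M] : Module.Finite ℤ (MonoidAlgebra ℤ M) :=
  Module.Finite.of_basis (MonoidAlgebra.basis M ℤ)

instance [Finite M] : IsNoetherianRing (MonoidAlgebra ℤ M) :=
  isNoetherian_of_tower ℤ inferInstance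

instance [Finite M] : Module.Finite ℤ (LClassModule e) :=
  have : Module.Finite (MonoidAlgebra ℤ M) (LClassModule e) := inferInstance
  Module.Finite.trans (MonoidAlgebra ℤ M) _

/-- Right multiplication by a unit of `eMe`. -/
noncomputable def mulRight (he : e * e = e) (g : CornerUnit e) :
    LClassModule e →ₗ[MonoidAlgebra ℤ M] LClassModule e :=
  lift (of ℤ M g.val • gen e) fun x hx => by
    rw [← mul_smul, ← map_mul]
    refine smul_gen_eq_zero he ?_
    obtain ⟨⟨c, rfl⟩, h⟩ := hx
    exact ⟨⟨c * g.val, by rw [mul_assoc, mul_assoc, g.mul_val, g.val_mul]⟩,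
      fun h' => h (h'.trans (JLE.mul_right _ _))⟩

lemma mulRight_gen (he : e * e = e) (g : CornerUnit e) :
    mulRight he g (gen e) = of ℤ M g.val • gen e :=
  lift_gen _ _ (by rw [← mul_smul, ← map_mul, g.mul_val])

end LClassModule

/-! ### The group action on the fixed points of an idempotent. -/

section Induction

variable (e : M) (V : Type u) [AddCommGroup V] [Module (MonoidAlgebra ℤ M) V]

/-- The fixed points of an element of `M`. -/
noncomputable def fixedPoints : Submodule ℤ V where
  carrier := {v | of ℤ M e • v = v}
  add_mem' {v w} hv hw := by
    simp only [Set.mem_ofPred_eq] at *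
    rw [smul_add, hv, hw]
  zero_mem' := smul_zero _
  smul_mem' n v hv := by
    simp only [Set.mem_ofPred_eq] at *
    rw [smul_comm, hv]

variable {e V}

/-- Multiplication by a unit of `eMe` on the fixed points of `e`. -/
noncomputable def CornerUnit.act (g : CornerUnit e) : fixedPoints e V →ₗ[ℤ] fixedPoints e V where
  toFun w := ⟨of ℤ M g.val • (w : V), by
    change of ℤ M e • of ℤ M g.val • (w : V) = _
    rw [← mul_smul, ← map_mul, g.mul_val]⟩
  map_add' v w := Subtype.ext (smul_add _ _ _)
  map_smul' n v := Subtype.ext (smul_comm _ _ _)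

lemma CornerUnit.coe_act (g : CornerUnit e) (w : fixedPoints e V) :
    (g.act w : V) = of ℤ M g.val • (w : V) := rfl

lemma CornerUnit.act_mul (g h : CornerUnit e) (w : fixedPoints e V) :
    (g.mul h).act w = g.act (h.act w) :=
  Subtype.ext (by simp only [coe_act, ← mul_smul, ← map_mul]; rfl)

lemma CornerUnit.act_symm_act (g : CornerUnit e) (w : fixedPoints e V) :
    g.symm.act (g.act w) = w :=
  Subtype.ext (by
    rw [coe_act, coe_act, ← mul_smul, ← map_mul]
    change of ℤ M (g.inv * g.val) • (w : V) = w
    rw [g.inv_mul_val]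
    exact w.2)

lemma CornerUnit.act_act_symm (g : CornerUnit e) (w : fixedPoints e V) :
    g.act (g.symm.act w) = w :=
  g.symm.act_symm_act w

/-- Projection to the fixed points of an idempotent. -/
noncomputable def toFixedPoints (he : e * e = e) : V →ₗ[ℤ] fixedPoints e V where
  toFun v := ⟨of ℤ M e • v, by
    change of ℤ M e • of ℤ M e • v = of ℤ M e • v
    rw [← mul_smul, ← map_mul, he]⟩
  map_add' v w := Subtype.ext (smul_add _ _ _)
  map_smul' n v := Subtype.ext (smul_comm _ _ _)

end Induction

open LClassModule

/-! ### Induction from the maximal subgroup. -/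

section Induced

variable {e : M} (he : e * e = e) (V : Type u) [AddCommGroup V] [Module (MonoidAlgebra ℤ M) V]

/-- The relations `s g ⊗ w - s ⊗ g w` defining the induced module. -/
noncomputable def inducedRel :
    Submodule (MonoidAlgebra ℤ M) (LClassModule e ⊗[ℤ] fixedPoints e V) :=
  ⨆ g : CornerUnit e, LinearMap.range
    (TensorProduct.AlgebraTensorModule.map (mulRight he g) LinearMap.id -
      TensorProduct.AlgebraTensorModule.map LinearMap.id g.act)

/-- The module induced from the fixed points of `e`, a module over the maximal subgroup at `e`. -/
abbrev Induced : Type u := (LClassModule e ⊗[ℤ] fixedPoints e V) ⧸ inducedRel he V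

variable {V}

lemma inducedRel_le_ker {Z : Type*} [AddCommGroup Z] [Module (MonoidAlgebra ℤ M) Z]
    (f : LClassModule e ⊗[ℤ] fixedPoints e V →ₗ[MonoidAlgebra ℤ M] Z)
    (h : ∀ (g : CornerUnit e) w, of ℤ M g.val • f (gen e ⊗ₜ w) = f (gen e ⊗ₜ g.act w)) :
    inducedRel he V ≤ LinearMap.ker f := by
  refine iSup_le fun g => LinearMap.range_le_ker_iff.2 ?_
  rw [LinearMap.comp_sub, sub_eq_zero]
  refine tensor_hom_ext he fun w => ?_
  simp only [LinearMap.comp_apply, TensorProduct.AlgebraTensorModule.map_tmul, LinearMap.id_apply,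
    mulRight_gen]
  rw [← TensorProduct.smul_tmul', map_smul, h]

lemma mk_smul_gen_tmul (g : CornerUnit e) (w : fixedPoints e V) :
    (inducedRel he V).mkQ ((of ℤ M g.val • gen e) ⊗ₜ w) =
      (inducedRel he V).mkQ (gen e ⊗ₜ g.act w) := by
  rw [← sub_eq_zero, ← map_sub, Submodule.mkQ_apply, Submodule.Quotient.mk_eq_zero]
  refine (le_iSup (fun g : CornerUnit e => LinearMap.range
    (TensorProduct.AlgebraTensorModule.map (mulRight he g) LinearMap.id -
      TensorProduct.AlgebraTensorModule.map LinearMap.id g.act)) g) ⟨gen e ⊗ₜ w, ?_⟩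
  simp [mulRight_gen]

/-- Averaging over the maximal subgroup. -/
noncomputable def averaging [Finite M] : LClassModule e ⊗[ℤ] fixedPoints e V →ₗ[MonoidAlgebra ℤ M]
    LClassModule e ⊗[ℤ] fixedPoints e V :=
  ∑ g : CornerUnit e, TensorProduct.AlgebraTensorModule.map (mulRight he g) g.symm.act

lemma averaging_gen_tmul [Finite M] (w : fixedPoints e V) : averaging he (gen e ⊗ₜ[ℤ] w) =
    ∑ g : CornerUnit e, (of ℤ M g.val • gen e) ⊗ₜ[ℤ] g.symm.act w := by
  simp [averaging, LinearMap.sum_apply, mulRight_gen]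

/-- Substituting h g for g in Σ g ⊗ g⁻¹ w moves h across the tensor sign. -/
lemma inducedRel_le_ker_averaging [Finite M] : inducedRel he V ≤ LinearMap.ker (averaging he) := by
  refine inducedRel_le_ker he _ fun h w => ?_
  rw [averaging_gen_tmul, averaging_gen_tmul, Finset.smul_sum]
  refine Fintype.sum_equiv h.mulLeft _ _ fun g => ?_
  have h1 : (h.mul g).symm.act (h.act w) = g.symm.act w := by
    have h2 : (h.mul g).symm = g.symm.mul h.symm := rfl
    rw [h2, CornerUnit.act_mul, CornerUnit.act_symm_act]
  change _ = (of ℤ M (h.val * g.val) • gen e) ⊗ₜ[ℤ] (h.mul g).symm.act (h.act w)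
  rw [h1, map_mul, mul_smul, TensorProduct.smul_tmul']

/-- Averaging descends to the induced module; followed by the projection it is multiplication by the
order of the maximal subgroup. -/
theorem eventuallyTorsionExt_induced [Finite M] (hM : IsRegularSemigroup M) [Module.Finite ℤ V] :
    EventuallyTorsionExt (ModuleCat.of (MonoidAlgebra ℤ M) (Induced he V)) := by
  refine .of_linearMap_comp ((inducedRel he V).liftQ _ (inducedRel_le_ker_averaging he))
    (inducedRel he V).mkQ (CornerUnit.card_pos he) (fun u => ?_)
    ((eventuallyTorsionExt_LClassModule hM e).tensorProduct (fixedPoints e V))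
  obtain ⟨t, rfl⟩ := (inducedRel he V).mkQ_surjective u
  have : (inducedRel he V).mkQ ∘ₗ averaging he =
      Fintype.card (CornerUnit e) • (inducedRel he V).mkQ := by
    refine tensor_hom_ext he fun w => ?_
    rw [LinearMap.comp_apply, averaging_gen_tmul, map_sum]
    simp only [mk_smul_gen_tmul, CornerUnit.act_act_symm]
    rw [Finset.sum_const, Finset.card_univ]
    rfl
  exact LinearMap.congr_fun this t

variable (V) in
/-- The action map `s ⊗ w ↦ s w`. -/
noncomputable def actionMap (hV : ∀ x ∈ lowerLeftIdeal e, ∀ v : V, of ℤ M x • v = 0) :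
    LClassModule e ⊗[ℤ] fixedPoints e V →ₗ[MonoidAlgebra ℤ M] V :=
  TensorProduct.AlgebraTensorModule.lift
    (LClassModule.lift (fixedPoints e V).subtype fun x hx => LinearMap.ext fun w => hV x hx w)

variable (hV : ∀ x ∈ lowerLeftIdeal e, ∀ v : V, of ℤ M x • v = 0)

lemma actionMap_gen_tmul (w : fixedPoints e V) : actionMap V hV (gen e ⊗ₜ w) = w := by
  rw [actionMap, TensorProduct.AlgebraTensorModule.lift_tmul,
    LClassModule.lift_gen _ _ (LinearMap.ext fun w => w.2)]
  rfl

/-- The action map on the induced module. -/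
noncomputable def inducedMap : Induced he V →ₗ[MonoidAlgebra ℤ M] V :=
  (inducedRel he V).liftQ (actionMap V hV) (inducedRel_le_ker he _ fun g w => by
    rw [actionMap_gen_tmul, actionMap_gen_tmul, g.coe_act])

/-- On the induced module, e acts through the action map alone, so it kills the kernel of
`inducedMap`. The reason is a dichotomy for e c e, as follows. -/
lemma smul_mk [Finite M] (hV : ∀ x ∈ lowerLeftIdeal e, ∀ v : V, of ℤ M x • v = 0)
    (t : LClassModule e ⊗[ℤ] fixedPoints e V) :
    of ℤ M e • (inducedRel he V).mkQ t =
      (inducedRel he V).mkQ (gen e ⊗ₜ toFixedPoints he (actionMap V hV t)) := by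
  induction t with
  | zero => simp
  | add x y hx hy =>
    rw [map_add, smul_add, hx, hy, map_add, map_add, TensorProduct.tmul_add, map_add]
  | tmul s w =>
    obtain ⟨f, rfl⟩ := exists_eq_smul_gen he s
    rw [← TensorProduct.smul_tmul']
    induction f using MonoidAlgebra.induction_on with
    | add f g hf hg =>
      rw [add_smul, map_add, smul_add, hf, hg, map_add, map_add, TensorProduct.tmul_add, map_add]
    | smul n f hf =>
      have h1 : (n • f) • (gen e ⊗ₜ[ℤ] w) = n • f • (gen e ⊗ₜ[ℤ] w) := smul_assoc n f _
      rw [h1, map_zsmul, smul_comm, hf, map_zsmul, map_zsmul, TensorProduct.tmul_smul, map_zsmul]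
    | of c =>
      have hexe : of ℤ M e • of ℤ M c • (gen e ⊗ₜ[ℤ] w) = of ℤ M (e * c * e) • (gen e ⊗ₜ[ℤ] w) := by
        conv_lhs => rw [← of_smul_gen he, ← TensorProduct.smul_tmul']
        simp only [map_mul, mul_smul]
      have hact : (toFixedPoints he (actionMap V hV (of ℤ M c • (gen e ⊗ₜ w))) : V) =
          of ℤ M (e * c * e) • (w : V) := by
        change of ℤ M e • _ = _
        rw [map_smul, actionMap_gen_tmul, map_mul, map_mul, mul_smul, mul_smul, w.2]
      rw [← map_smul, hexe]
      -- Either e c e is a unit of eMe and crosses the tensor sign, or it is strictly J-below e and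
      -- both sides vanish.
      by_cases hx : JLE e (e * c * e)
      · obtain ⟨g, hg⟩ := CornerUnit.exists_of_JLE (by simp only [← mul_assoc, he])
          (by rw [mul_assoc (e * c), he]) hx he
        rw [← hg] at hact ⊢
        rw [TensorProduct.smul_tmul', mk_smul_gen_tmul]
        congr 2
        exact Subtype.ext hact.symm
      · have hlow : e * c * e ∈ lowerLeftIdeal e := ⟨⟨e * c, rfl⟩, hx⟩
        have hact' : toFixedPoints he (actionMap V hV (of ℤ M c • (gen e ⊗ₜ w))) = 0 :=
          Subtype.ext (hact.trans (hV _ hlow _))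
        rw [TensorProduct.smul_tmul', smul_gen_eq_zero he hlow, hact',
          TensorProduct.zero_tmul, TensorProduct.tmul_zero]

lemma smul_ker_inducedMap [Finite M] (u : LinearMap.ker (inducedMap he hV)) : of ℤ M e • u = 0 := by
  obtain ⟨u, hu⟩ := u
  refine Subtype.ext ?_
  obtain ⟨t, rfl⟩ := (inducedRel he V).mkQ_surjective u
  change of ℤ M e • (inducedRel he V).mkQ t = 0
  have h : actionMap V hV t = 0 := hu
  rw [smul_mk he hV, h, map_zero, TensorProduct.tmul_zero, map_zero]

lemma smul_mem_range_inducedMap (v : V) : of ℤ M e • v ∈ LinearMap.range (inducedMap he hV) :=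
  ⟨(inducedRel he V).mkQ (gen e ⊗ₜ toFixedPoints he v), actionMap_gen_tmul hV _⟩

/-- Ensures that an ideal avoiding e kills the induced module, hence the kernel of `inducedMap`. -/
lemma smul_induced_eq_zero {x : M} (hx : ∀ c, ¬ JLE e (x * c * e)) (u : Induced he V) :
    of ℤ M x • u = 0 := by
  obtain ⟨t, rfl⟩ := (inducedRel he V).mkQ_surjective u
  rw [← map_smul]
  suffices of ℤ M x • t = 0 by rw [this, map_zero]
  induction t with
  | zero => simp
  | add s t hs ht => rw [smul_add, hs, ht, add_zero]
  | tmul s w =>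
    obtain ⟨f, rfl⟩ := exists_eq_smul_gen he s
    rw [TensorProduct.smul_tmul']
    suffices of ℤ M x • f • gen e = 0 by rw [this, TensorProduct.zero_tmul]
    induction f using MonoidAlgebra.induction_on with
    | add f g hf hg => rw [add_smul, smul_add, hf, hg, add_zero]
    | smul n f hf => rw [smul_assoc, smul_comm, hf, smul_zero]
    | of c =>
      rw [← of_smul_gen he, ← mul_smul, ← mul_smul, ← map_mul, ← map_mul]
      exact smul_gen_eq_zero he ⟨⟨_, rfl⟩, hx c⟩

end Induced

/-- If a finite regular monoid `M` acts on a finitely generated abelian group, with a two-sided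
ideal of `M` acting by zero, then `Ext` out of the corresponding `ℤM`-module is eventually
torsion. -/
theorem eventuallyTorsionExt_of_ideal [Finite M] (hM : IsRegularSemigroup M) {I : Set M}
    (hI : ∀ x ∈ I, ∀ y, JLE y x → y ∈ I) (V : Type u) [AddCommGroup V]
    [Module (MonoidAlgebra ℤ M) V] [Module.Finite ℤ V]
    (hV : ∀ x ∈ I, ∀ v : V, of ℤ M x • v = 0) :
    EventuallyTorsionExt (ModuleCat.of (MonoidAlgebra ℤ M) V) := by
  induction hn : Iᶜ.ncard using Nat.strong_induction_on generalizing I V with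
  | _ n ih =>
  rcases Iᶜ.eq_empty_or_nonempty with h0 | hne
  · have : Subsingleton V := ⟨fun v w => by
      have h1 : (1 : M) ∈ I := by
        rw [Set.compl_empty_iff] at h0
        rw [h0]
        trivial
      have h2 : ∀ v : V, v = 0 := fun v => by
        rw [← hV 1 h1 v, map_one, one_smul]
      rw [h2 v, h2 w]⟩
    exact .of_subsingleton V
  -- The J-class of a is minimal outside I, so everything strictly J-below it lies in I and kills V.
  -- Regularity then replaces a by the idempotent t a of the same J-class.
  obtain ⟨a, ha, hmin⟩ :=
    (Set.toFinite Iᶜ).exists_minimalFor (fun a => (principalIdeal a).ncard) Iᶜ hne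
  obtain ⟨t, ht⟩ := hM a
  have hae : a * (t * a) = a := by rw [← mul_assoc, ht]
  obtain ⟨e, he, heI, hJ⟩ : ∃ e : M, e * e = e ∧ e ∉ I ∧ ∀ y, JLE y e → y ∉ I → JLE e y := by
    have hJea : JLE (t * a) a := JLE.mul_left t a
    refine ⟨t * a, by rw [mul_assoc, hae], fun h => ha (hI _ h a ?_), fun y hy hyI => ?_⟩
    · exact ⟨a, 1, by rw [hae, mul_one]⟩
    · have hya := hy.trans hJea
      exact hJea.trans (hya.of_ncard_le (hmin hyI (ncard_principalIdeal_le hya)))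
  have hlow : ∀ x ∈ lowerLeftIdeal e, x ∈ I := by
    rintro _ ⟨⟨c, rfl⟩, h⟩
    by_contra hc
    exact h (hJ _ (JLE.mul_left c e) hc)
  let I' : Set M := I ∪ principalIdeal e
  have hI' : ∀ x ∈ I', ∀ y, JLE y x → y ∈ I' := by
    rintro x (hx | hx) y hy
    · exact Or.inl (hI x hx y hy)
    · exact Or.inr (JLE.trans hy hx)
  have hcard : I'ᶜ.ncard < n := by
    rw [← hn]
    refine Set.ncard_lt_ncard ⟨Set.compl_subset_compl.2 Set.subset_union_left, fun h => ?_⟩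
    exact h heI (Or.inr (JLE.refl e))
  have hVlow : ∀ x ∈ lowerLeftIdeal e, ∀ v : V, of ℤ M x • v = 0 := fun x hx => hV x (hlow x hx)
  have hU : Module.Finite ℤ (Induced he V) := by
    have : Module.Finite ℤ (LClassModule e ⊗[ℤ] fixedPoints e V) :=
      Module.Finite.tensorProduct ℤ _ _
    have : Module.Finite (MonoidAlgebra ℤ M) (LClassModule e ⊗[ℤ] fixedPoints e V) :=
      Module.Finite.of_restrictScalars_finite ℤ _ _
    exact Module.Finite.trans (MonoidAlgebra ℤ M) _
  have hUA : Module.Finite (MonoidAlgebra ℤ M) (Induced he V) :=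
    Module.Finite.of_restrictScalars_finite ℤ _ _
  have hVA : Module.Finite (MonoidAlgebra ℤ M) V := Module.Finite.of_restrictScalars_finite ℤ _ _
  have hKfin : Module.Finite ℤ (LinearMap.ker (inducedMap he hVlow)) :=
    Module.Finite.trans (MonoidAlgebra ℤ M) _
  have hCfin : Module.Finite ℤ (V ⧸ LinearMap.range (inducedMap he hVlow)) :=
    Module.Finite.trans (MonoidAlgebra ℤ M) _
  -- Kernel and cokernel are killed by I and by e, hence by all of I ∪ MeM.
  refine .of_linearMap (inducedMap he hVlow) (eventuallyTorsionExt_induced he hM)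
    (ih _ hcard hI' _ ?_ rfl) (ih _ hcard hI' _ ?_ rfl)
  · rintro x (hx | ⟨p, q, rfl⟩) u
    · refine Subtype.ext (smul_induced_eq_zero he (fun c h => heI (hI _ hx e (h.trans ?_))) u.1)
      exact ⟨1, c * e, by rw [one_mul, mul_assoc]⟩
    · rw [map_mul, map_mul, mul_smul, mul_smul, smul_ker_inducedMap, smul_zero]
  · rintro x hx u
    obtain ⟨v, rfl⟩ := Submodule.mkQ_surjective _ u
    rw [← map_smul, Submodule.mkQ_apply, Submodule.Quotient.mk_eq_zero]
    rcases hx with hx | ⟨p, q, rfl⟩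
    · rw [hV x hx]
      exact Submodule.zero_mem _
    · rw [map_mul, map_mul, mul_smul, mul_smul]
      exact Submodule.smul_mem _ _ (smul_mem_range_inducedMap he hVlow _)

end MonoidHomology

theorem corollaryc {M : Type u} [Monoid M] [Finite M]
    (hM : MonoidHomology.IsRegularSemigroup M) :
    ∃ N : ℕ, ∀ n : ℕ, N ≤ n → Finite (MonoidHomology.integralHomology M n) := by
  have : Module.Finite ℤ (MonoidHomology.TrivialModule M) :=
    inferInstanceAs (Module.Finite ℤ (ULift.{u} ℤ))
  have : Module.Finite (MonoidAlgebra ℤ M) (MonoidHomology.TrivialModule M) :=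
    Module.Finite.of_restrictScalars_finite ℤ _ _
  exact MonoidHomology.exists_forall_finite_TorGroup (MonoidAlgebra ℤ M)
    (MonoidHomology.TrivialModule M) (ModuleCat.of _ (MonoidHomology.TrivialModule M))
    -- The induction starts from the empty ideal, which imposes no condition on the module.
    (MonoidHomology.eventuallyTorsionExt_of_ideal hM (I := ∅) (fun _ h => h.elim) _
      (fun _ h => h.elim))
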